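/- Let $A\in\mathbb R^{n\times n}$, let $E\in\mathbb R^{n}$ be a column vector and $C\in\mathbb R^{1\times n}$ a row vector, with $(A,C)$ observable and $(A,E)$ controllable, and let $V\ge 0$ and $W>0$ be real numbers (noise covariances). Let $\Sigma$ be the positive definite solution of $$0=A\Sigma+\Sigma A^T+EVE^T-\Sigma C^TW^{-1}C\Sigma ,\qquad L=\Sigma C^TW^{-1}.$$ Let $\tau>0$ and let $(A_N,B_N,C_N,D_N)$, with state dimension $N$, be a minimal realization (a realization of least state dimension) of the $N$-th order (diagonal $[N/N]$) Padé approximant $P_N(s)$ of the delay $e^{-s\tau}$. Put $$A_{aug}=\begin{bmatrix}A&0\\ B_NC&A_N\end{bmatrix},\qquad E_{aug}=\begin{bmatrix}E\\0\end{bmatrix},\qquad C_{aug}=\begin{bmatrix}D_NC&C_N\end{bmatrix},$$ assume that $(A_{aug},C_{aug})$ is observable and $(A_{aug},E_{aug})$ is controllable, and let $\Sigma_{aug}$ be the positive definite solution of $$0=A_{aug}\Sigma_{aug}+\Sigma_{aug}A_{aug}^T+E_{aug}VE_{aug}^T-\Sigma_{aug}C_{aug}^TW^{-1}C_{aug}\Sigma_{aug},\qquad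 L_{aug}=\Sigma_{aug}C_{aug}^TW^{-1}.$$ Then the following hold. (i) The $N$ eigenvalues of $A_N$ are, with multiplicity, eigenvalues of $A_{aug}-L_{aug}C_{aug}$ (the characteristic polynomial of $A_N$ divides that of $A_{aug}-L_{aug}C_{aug}$), and they are, with multiplicity, uncontrollable eigenvalues of $(A_{aug},L_{aug})$. That is, for each eigenvalue $\mu$ of $A_N$ there is $x\neq 0$ with $x^TA_{aug}=\mu x^T$ and $x^TL_{aug}=0$, and the generalized left eigenvectors of $A_{aug}$ for $\mu$ that annihilate $A_{aug}^kL_{aug}$ for all $k\ge 0$ form a space of dimension at least the algebraic multiplicity of $\mu$ in $A_N$. (ii) As rational functions of $s$, $$C_{aug}(sI-A_{aug})^{-1}L_{aug}=C(sI-A)^{-1}L ,$$ and if $A$ and $A-LC$ have no common eigenvalue, then $(A,L,C)$ is a minimal realization of this transfer function. (iii) $1+C_{aug}(sI-A_{aug})^{-1}L_{aug}$ is not the zero rational function, and the tradeoff filter satisfies $$\bigl(1+C_{aug}(sI-A_{aug})^{-1}L_{aug}\bigr)^{-1}=F(s)=\bigl(1+C(sI-A)^{-1}L\bigr)^{-1},$$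 so it does not depend on the delay $\tau$ or on the order $N$. -/

import Mathlib

open scoped Matrix
open Polynomial

noncomputable section

namespace DelayEstimator

section StateSpace

variable {ι : Type*} [Fintype ι] [DecidableEq ι]

/-- The transfer function `c (sI - A)⁻¹ b + d`, as a real rational function of `s`, of the
single input, single output system `x' = A x + b u`, `y = c x + d u`. The matrix `sI - A` is
invertible over the field of rational functions, since its determinant is monic. -/
def transferFunction (A : Matrix ι ι ℝ) (b c : ι → ℝ) (d : ℝ) : RatFunc ℝ :=
  (fun i => RatFunc.C (c i)) ⬝ᵥ
      (((RatFunc.X : RatFunc ℝ) • (1 : Matrix ι ι (RatFunc ℝ)) - A.map RatFunc.C)⁻¹ *ᵥ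
        (fun i => RatFunc.C (b i)))
    + RatFunc.C d

/-- `(A, b)` is controllable: the reachable subspace, spanned by `b, A b, A² b, …`, is the whole
state space. -/
def IsControllable (A : Matrix ι ι ℝ) (b : ι → ℝ) : Prop :=
  Submodule.span ℝ (Set.range fun k : ℕ => (A ^ k) *ᵥ b) = ⊤

/-- `(A, c)` is observable: the unobservable subspace `{x | c Aᵏ x = 0 for all k}` is zero. -/
def IsObservable (A : Matrix ι ι ℝ) (c : ι → ℝ) : Prop :=
  ∀ x : ι → ℝ, (∀ k : ℕ, c ⬝ᵥ ((A ^ k) *ᵥ x) = 0) → x = 0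

/-- A real matrix, regarded as a complex one. -/
abbrev toComplex {κ κ' : Type*} (A : Matrix κ κ' ℝ) : Matrix κ κ' ℂ := A.map Complex.ofReal

/-- `μ` is an uncontrollable eigenvalue of `(A, b)`: there is a left eigenvector of `A` for `μ`
that annihilates `b`; equivalently the matrix `[μI - A, b]` has deficient row rank. -/
def IsUncontrollableEigenvalue (A : Matrix ι ι ℝ) (b : ι → ℝ) (μ : ℂ) : Prop :=
  ∃ x : ι → ℂ, x ≠ 0 ∧ x ᵥ* toComplex A = μ • x ∧ x ⬝ᵥ (fun i => (b i : ℂ)) = 0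

/-- The complex row vectors that annihilate the reachable subspace of `(A, b)`. -/
def uncontrollableSubspace (A : Matrix ι ι ℝ) (b : ι → ℝ) : Submodule ℂ (ι → ℂ) where
  carrier := {x | ∀ k : ℕ, x ⬝ᵥ ((toComplex A ^ k) *ᵥ fun i => (b i : ℂ)) = 0}
  add_mem' := by
    intro x y hx hy k
    rw [add_dotProduct, hx k, hy k, add_zero]
  zero_mem' := by
    intro k
    exact zero_dotProduct _
  smul_mem' := by
    intro r x hx k
    rw [smul_dotProduct, hx k, smul_zero]

/-- The algebraic multiplicity of `μ` as an uncontrollable eigenvalue of `(A, b)`: the dimension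
of the space of generalized left eigenvectors of `A` for `μ` that annihilate the reachable
subspace, i.e. the multiplicity of `μ` in the uncontrollable part of `(A, b)`. -/
def uncontrollableMultiplicity (A : Matrix ι ι ℝ) (b : ι → ℝ) (μ : ℂ) : ℕ :=
  Module.finrank ℂ
    ↥(uncontrollableSubspace A b ⊓
      Module.End.maxGenEigenspace (Matrix.toLin' (toComplex A)ᵀ) μ)

/-- `S` is a positive definite solution of the filter algebraic Riccati equation
`0 = A S + S Aᵀ + e V eᵀ - S cᵀ W⁻¹ c S`. -/
def IsPosDefRiccatiSolution (A : Matrix ι ι ℝ) (e c : ι → ℝ) (V W : ℝ) (S : Matrix ι ι ℝ) :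
    Prop :=
  S.PosDef ∧
    0 = A * S + S * Aᵀ + V • Matrix.vecMulVec e e - S * (W⁻¹ • Matrix.vecMulVec c c) * S

/-- The estimator gain `S cᵀ W⁻¹`. -/
def estimatorGain (S : Matrix ι ι ℝ) (c : ι → ℝ) (W : ℝ) : ι → ℝ := W⁻¹ • (S *ᵥ c)

/-- The closed loop estimator matrix `A - l c`. -/
def closedLoop (A : Matrix ι ι ℝ) (l c : ι → ℝ) : Matrix ι ι ℝ := A - Matrix.vecMulVec l c

end StateSpace

/-- `(A, b, c, d)` is a minimal realization of `P`: its transfer function is `P`, and no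
realization of `P` has a smaller state dimension. -/
def IsMinimalRealization {n : ℕ} (A : Matrix (Fin n) (Fin n) ℝ) (b c : Fin n → ℝ) (d : ℝ)
    (P : RatFunc ℝ) : Prop :=
  transferFunction A b c d = P ∧
    ∀ (m : ℕ) (A' : Matrix (Fin m) (Fin m) ℝ) (b' c' : Fin m → ℝ) (d' : ℝ),
      transferFunction A' b' c' d' = P → n ≤ m

/-- `P` is the `N`-th order (diagonal, `[N/N]`) Padé approximant of the delay `exp (-τ s)`:
`P = p / q` with `deg p, deg q ≤ N`, `q 0 = 1` and `exp (-τ s) q(s) - p(s) = O(s ^ (2N+1))`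
as power series in `s`. -/
def IsPadeDelay (N : ℕ) (τ : ℝ) (P : RatFunc ℝ) : Prop :=
  ∃ p q : ℝ[X], p.natDegree ≤ N ∧ q.natDegree ≤ N ∧ q.coeff 0 = 1 ∧
    (PowerSeries.X : PowerSeries ℝ) ^ (2 * N + 1) ∣
      PowerSeries.rescale (-τ) (PowerSeries.exp ℝ) * (q : PowerSeries ℝ) - (p : PowerSeries ℝ) ∧
    P = algebraMap ℝ[X] (RatFunc ℝ) p / algebraMap ℝ[X] (RatFunc ℝ) q

/-- The state matrix `[A 0; B_N C, A_N]` of the plant augmented by the delay model. -/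
def augA {n N : ℕ} (A : Matrix (Fin n) (Fin n) ℝ) (C : Fin n → ℝ)
    (AN : Matrix (Fin N) (Fin N) ℝ) (BN : Fin N → ℝ) :
    Matrix (Fin n ⊕ Fin N) (Fin n ⊕ Fin N) ℝ :=
  Matrix.fromBlocks A 0 (Matrix.vecMulVec BN C) AN

/-- The disturbance input vector `[E; 0]` of the augmented system. -/
def augE {n : ℕ} (N : ℕ) (E : Fin n → ℝ) : Fin n ⊕ Fin N → ℝ := Sum.elim E 0

/-- The output row vector `[D_N C, C_N]` of the augmented system. -/
def augC {n N : ℕ} (C : Fin n → ℝ) (CN : Fin N → ℝ) (DN : ℝ) : Fin n ⊕ Fin N → ℝ :=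
  Sum.elim (DN • C) CN

end DelayEstimator

end

noncomputable section

namespace DelayEstimator

open Matrix

/-! Write χ for the characteristic polynomial of `A`, χ_N for that of `AN`, ψ and φ for those of the
two closed loops, f~(s) for f(-s), and let R/χ_N be the transfer function of the delay model.
Sandwiching the Riccati equation between rows of adjugates gives the spectral factorization W ψψ~ =
W χχ~ + V νν~, where ν is the numerator of C(sI - A)⁻¹E (`eval_charpoly_closedLoop_mul`). For the
augmented system χ becomes χχ_N and ν becomes νR (`numerator_aug`).

A diagonal Padé approximant of a delay is all-pass (`IsPadePair.mul_comp_neg_X`), so RR~ = χ_Nχ_N~,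
and therefore φφ~ = (ψχ_N)(ψχ_N)~. Both φ and ψχ_N have all their roots in the open left half plane:
the estimators are stable by a Lyapunov argument (`re_neg_of_isRoot_charpoly_closedLoop`), and the
Padé denominator is stable by an orthogonality argument (`IsPadePair.re_neg_of_isRoot`). Uniqueness
of spectral factors yields φ = ψχ_N.

The rest is algebra. By the matrix determinant lemma, one plus the loop transfer function is
φ/(χχ_N) = ψ/χ. Since χ clears the denominator of the augmented loop, observability gives χ(A_aug)
L_aug = 0, so the factor χ_N of the open loop characteristic polynomial χχ_N is uncontrollable. -/

theorem comp_mulVec {ι R R' : Type*} [Fintype ι] [CommRing R] [CommRing R'] (f : R →+* R')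
    (A : Matrix ι ι R) (v : ι → R) : f ∘ (A *ᵥ v) = A.map f *ᵥ (f ∘ v) :=
  funext fun i => f.map_mulVec A v i

/-! ### Numerators of transfer functions and the matrix determinant lemma. -/

section Numerator

variable {ι : Type*} [Fintype ι] [DecidableEq ι]

/-- The matrix determinant lemma, in terms of the adjugate. -/
theorem det_add_vecMulVec {R : Type*} [CommRing R] [IsDomain R] (A : Matrix ι ι R)
    (u v : ι → R) (hA : A.det ≠ 0) :
    (A + vecMulVec u v).det = A.det + v ⬝ᵥ (A.adjugate *ᵥ u) := by
  let K := FractionRing R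
  let f : R →+* K := algebraMap R K
  have hf : Function.Injective f := IsFractionRing.injective R K
  let B : Matrix ι ι K := A.map f
  have hB : B.det = f A.det := (f.map_det A).symm
  have hBu : IsUnit B.det := by
    rw [hB, isUnit_iff_ne_zero]
    exact (map_ne_zero_iff f hf).2 hA
  apply hf
  have h1 : f (A + vecMulVec u v).det = (B + vecMulVec (f ∘ u) (f ∘ v)).det := by
    rw [f.map_det]
    congr 1
    ext i j
    simp [B, vecMulVec_apply]
  have h2 : f (v ⬝ᵥ (A.adjugate *ᵥ u)) = (f ∘ v) ⬝ᵥ (B.adjugate *ᵥ (f ∘ u)) := by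
    have : B.adjugate = A.adjugate.map f := (f.map_adjugate A).symm
    rw [this, RingHom.map_dotProduct, comp_mulVec]
  rw [map_add, h1, h2, ← hB, vecMulVec_eq Unit,
    det_add_replicateCol_mul_replicateRow (ι := Unit) hBu,
    det_unique (n := Unit), Matrix.add_apply, Matrix.mul_assoc, inv_def, Ring.inverse_eq_inv',
    Matrix.smul_mul, Matrix.mul_smul, Matrix.smul_apply]
  have h3 : (replicateRow Unit (f ∘ v) * (B.adjugate * replicateCol Unit (f ∘ u)))
      default default = (f ∘ v) ⬝ᵥ (B.adjugate *ᵥ (f ∘ u)) := by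
    simp [Matrix.mul_apply, dotProduct, mulVec]
  rw [h3, one_apply_eq, smul_eq_mul, mul_add, mul_one, mul_inv_cancel_left₀ hBu.ne_zero]

/-- The numerator `c adj(sI - A) b` of `c (sI - A)⁻¹ b`. -/
def numerator (A : Matrix ι ι ℝ) (b c : ι → ℝ) : ℝ[X] :=
  (fun i => C (c i)) ⬝ᵥ (A.charmatrix.adjugate *ᵥ fun i => C (b i))

theorem charpoly_closedLoop (A : Matrix ι ι ℝ) (b c : ι → ℝ) :
    (closedLoop A b c).charpoly = A.charpoly + numerator A b c := by
  have h : (closedLoop A b c).charmatrix =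
      A.charmatrix + vecMulVec (fun i => C (b i)) (fun i => C (c i)) := by
    ext1 i j
    simp only [closedLoop, charmatrix, RingHom.mapMatrix_apply, Matrix.sub_apply,
      Matrix.add_apply, Matrix.map_apply, vecMulVec_apply, C_sub, C_mul]
    ring
  rw [charpoly, h, det_add_vecMulVec _ _ _ (charpoly_monic A).ne_zero]
  rfl

/-- The numerator is a difference of two monic polynomials of the same degree. -/
theorem degree_numerator_lt (A : Matrix ι ι ℝ) (b c : ι → ℝ) :
    (numerator A b c).degree < A.charpoly.degree := by
  have h : numerator A b c = (closedLoop A b c).charpoly - A.charpoly := by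
    rw [charpoly_closedLoop]; ring
  have hd : (closedLoop A b c).charpoly.degree = A.charpoly.degree := by
    simp [charpoly_degree_eq_dim]
  rw [h, ← hd]
  refine degree_sub_lt_left hd (charpoly_monic _).ne_zero ?_
  rw [(charpoly_monic _).leadingCoeff, (charpoly_monic _).leadingCoeff]

theorem transferFunction_eq (A : Matrix ι ι ℝ) (b c : ι → ℝ) (d : ℝ) :
    transferFunction A b c d = algebraMap ℝ[X] (RatFunc ℝ) (numerator A b c) /
      algebraMap ℝ[X] (RatFunc ℝ) A.charpoly + RatFunc.C d := by
  let f : ℝ[X] →+* RatFunc ℝ := algebraMap ℝ[X] (RatFunc ℝ)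
  have h : (RatFunc.X : RatFunc ℝ) • (1 : Matrix ι ι (RatFunc ℝ)) - A.map RatFunc.C =
      A.charmatrix.map f := by
    ext1 i j
    by_cases hij : i = j
    · subst hij; simp [f, charmatrix_apply_eq]
    · simp [f, charmatrix_apply_ne _ _ _ hij, Matrix.one_apply_ne hij]
  have hdet : (A.charmatrix.map f).det = f A.charpoly := (f.map_det _).symm
  have hadj : (A.charmatrix.map f).adjugate = A.charmatrix.adjugate.map f :=
    (f.map_adjugate _).symm
  rw [transferFunction, h, inv_def, hdet, hadj, Ring.inverse_eq_inv', smul_mulVec,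
    dotProduct_smul, numerator]
  change _ = f _ / f _ + _
  rw [RingHom.map_dotProduct, comp_mulVec, smul_eq_mul, div_eq_inv_mul]
  congr 4

theorem numerator_add (A : Matrix ι ι ℝ) (b b' c : ι → ℝ) :
    numerator A (b + b') c = numerator A b c + numerator A b' c := by
  have : (fun i => C ((b + b') i)) = (fun i => C (b i)) + fun i => C (b' i) := by
    ext1 i; simp
  rw [numerator, this, mulVec_add, dotProduct_add]; rfl

theorem numerator_smul (A : Matrix ι ι ℝ) (r : ℝ) (b c : ι → ℝ) :
    numerator A (r • b) c = C r * numerator A b c := by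
  have : (fun i => C ((r • b) i)) = C r • (fun i => C (b i)) := by
    ext1 i; simp
  rw [numerator, this, mulVec_smul, dotProduct_smul]; rfl

theorem charmatrix_mulVec_C (A : Matrix ι ι ℝ) (b : ι → ℝ) :
    A.charmatrix *ᵥ (fun i => C (b i)) =
      (X : ℝ[X]) • (fun i => C (b i)) - fun i => C ((A *ᵥ b) i) := by
  rw [charmatrix, sub_mulVec, scalar_apply, ← smul_one_eq_diagonal, smul_mulVec, one_mulVec]
  congr 1
  ext1 i
  simp [mulVec, dotProduct]

/-- Write `A` as `X - (X - A)`: the adjugate turns the second term into the characteristic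
polynomial. -/
theorem numerator_mulVec (A : Matrix ι ι ℝ) (b c : ι → ℝ) :
    numerator A (A *ᵥ b) c = X * numerator A b c - C (c ⬝ᵥ b) * A.charpoly := by
  have h : (fun i => C ((A *ᵥ b) i)) =
      (X : ℝ[X]) • (fun i => C (b i)) - A.charmatrix *ᵥ (fun i => C (b i)) := by
    rw [charmatrix_mulVec_C]; abel
  have hc : (fun i => C (c i)) ⬝ᵥ (fun i => C (b i)) = C (c ⬝ᵥ b) := by
    simp [dotProduct]
  rw [numerator, h, mulVec_sub, mulVec_smul, dotProduct_sub, dotProduct_smul, mulVec_mulVec,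
    adjugate_mul, smul_mulVec, one_mulVec, dotProduct_smul, hc, smul_eq_mul, smul_eq_mul,
    mul_comm (C _)]
  rfl

theorem charpoly_dvd_numerator_aeval_sub (A : Matrix ι ι ℝ) (b c : ι → ℝ) (f : ℝ[X]) :
    A.charpoly ∣ numerator A (aeval A f *ᵥ b) c - f * numerator A b c := by
  induction f using Polynomial.induction_on with
  | C a =>
    rw [aeval_C, Algebra.algebraMap_eq_smul_one, smul_mulVec, one_mulVec, numerator_smul, sub_self]
    exact dvd_zero _
  | add p q hp hq =>
    rw [map_add, add_mulVec, numerator_add]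
    convert dvd_add hp hq using 1; ring
  | monomial k a h =>
    have : aeval A (C a * X ^ (k + 1)) *ᵥ b = A *ᵥ (aeval A (C a * X ^ k) *ᵥ b) := by
      rw [mulVec_mulVec]
      congr 1
      rw [pow_succ, ← mul_assoc, mul_comm _ X, map_mul, aeval_X]
    rw [this, numerator_mulVec]
    obtain ⟨g, hg⟩ := h
    refine ⟨X * g - C (c ⬝ᵥ (aeval A (C a * X ^ k) *ᵥ b)), ?_⟩
    linear_combination X * hg

/-- With a zero numerator for `b`, the one for `A b` is a constant multiple of the characteristic
polynomial; its degree is too small unless that constant, `-(c ⬝ᵥ b)`, vanishes. Then iterate. -/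
theorem dotProduct_pow_mulVec_eq_zero_of_numerator_eq_zero (A : Matrix ι ι ℝ) (b c : ι → ℝ)
    (h : numerator A b c = 0) (k : ℕ) : c ⬝ᵥ ((A ^ k) *ᵥ b) = 0 := by
  have key : ∀ b : ι → ℝ, numerator A b c = 0 → c ⬝ᵥ b = 0 ∧ numerator A (A *ᵥ b) c = 0 := by
    intro b h
    have h1 := numerator_mulVec A b c
    have h2 := degree_numerator_lt A (A *ᵥ b) c
    rw [h, mul_zero, zero_sub] at h1
    have h0 : c ⬝ᵥ b = 0 := by
      by_contra h0
      rw [h1, degree_neg, degree_C_mul h0] at h2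
      exact lt_irrefl _ h2
    exact ⟨h0, by rw [h1, h0]; simp⟩
  have : numerator A ((A ^ k) *ᵥ b) c = 0 := by
    induction k with
    | zero => simpa using h
    | succ k ih => rw [pow_succ', ← mulVec_mulVec]; exact (key _ ih).2
  exact (key _ this).1

/-- If `f` clears the denominator of `c (sI - A)⁻¹ b` and `(A, c)` is observable, then
`f(A) b = 0`. -/
theorem aeval_mulVec_eq_zero_of_charpoly_dvd (A : Matrix ι ι ℝ) (b c : ι → ℝ)
    (hobs : IsObservable A c) (f : ℝ[X]) (h : A.charpoly ∣ f * numerator A b c) :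
    aeval A f *ᵥ b = 0 := by
  apply hobs
  apply dotProduct_pow_mulVec_eq_zero_of_numerator_eq_zero
  have h1 := charpoly_dvd_numerator_aeval_sub A b c f
  exact eq_zero_of_dvd_of_degree_lt ((dvd_sub_left h).1 h1) (degree_numerator_lt _ _ _)

end Numerator

/-! ### Spectral factorization from the Riccati equation. -/

section Riccati

variable {ι : Type*} [Fintype ι] [DecidableEq ι]

theorem eval_charmatrix (A : Matrix ι ι ℝ) (z : ℝ) :
    A.charmatrix.map (eval z) = z • (1 : Matrix ι ι ℝ) - A := by
  ext i j
  by_cases hij : i = j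
  · subst hij; simp [charmatrix_apply_eq]
  · simp [charmatrix_apply_ne _ _ _ hij, Matrix.one_apply_ne hij]

theorem eval_numerator (A : Matrix ι ι ℝ) (b c : ι → ℝ) (z : ℝ) :
    (numerator A b c).eval z = (c ᵥ* (z • (1 : Matrix ι ι ℝ) - A).adjugate) ⬝ᵥ b := by
  have h : (z • (1 : Matrix ι ι ℝ) - A).adjugate = A.charmatrix.adjugate.map (evalRingHom z) := by
    rw [← eval_charmatrix]
    exact ((evalRingHom z).map_adjugate _).symm
  rw [← coe_evalRingHom, numerator, RingHom.map_dotProduct, comp_mulVec, h,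
    ← dotProduct_mulVec]
  congr 2 <;> (try ext i) <;> simp

theorem vecMul_adjugate_vecMul (A : Matrix ι ι ℝ) (c : ι → ℝ) (z : ℝ) :
    (c ᵥ* (z • (1 : Matrix ι ι ℝ) - A).adjugate) ᵥ* (z • (1 : Matrix ι ι ℝ) - A) =
      A.charpoly.eval z • c := by
  have : (z • (1 : Matrix ι ι ℝ) - A).det = A.charpoly.eval z := by
    rw [← eval_charmatrix, charpoly]
    exact ((evalRingHom z).map_det _).symm
  rw [vecMul_vecMul, adjugate_mul, this, vecMul_smul, vecMul_one]

/-- The spectral factorization that underlies the filter Riccati equation. -/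
theorem eval_charpoly_closedLoop_mul (A : Matrix ι ι ℝ) (e c : ι → ℝ) (V W : ℝ) (hW : 0 < W)
    (S : Matrix ι ι ℝ) (hS : IsPosDefRiccatiSolution A e c V W S) (z : ℝ) :
    W * ((closedLoop A (estimatorGain S c W) c).charpoly.eval z *
        (closedLoop A (estimatorGain S c W) c).charpoly.eval (-z)) =
      W * (A.charpoly.eval z * A.charpoly.eval (-z)) +
        V * ((numerator A e c).eval z * (numerator A e c).eval (-z)) := by
  obtain ⟨hpos, hric⟩ := hS
  have hsymm : Sᵀ = S := by simpa using hpos.1.eq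
  set l := estimatorGain S c W with hl
  have hSc : S *ᵥ c = W • l := by
    rw [hl, estimatorGain, smul_smul, mul_inv_cancel₀ hW.ne', one_smul]
  -- The equation will be tested against these two rows; each is a left multiple of the resolvent at
  -- `z` or `-z`, up to the determinant.
  set x := c ᵥ* (z • (1 : Matrix ι ι ℝ) - A).adjugate with hx
  set y := c ᵥ* ((-z) • (1 : Matrix ι ι ℝ) - A).adjugate with hy
  have h1 := vecMul_adjugate_vecMul A c z
  have h2 := vecMul_adjugate_vecMul A c (-z)
  rw [← hx] at h1
  rw [← hy] at h2
  have hcS : c ᵥ* S = W • l := by rw [← hsymm, vecMul_transpose, hSc]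
  -- The Riccati equation is unchanged by shifting `A` by `-z` on the left and `z` on the right,
  -- since `z S` cancels.
  have hE : (z • (1 : Matrix ι ι ℝ) - A) * S + S * ((-z) • (1 : Matrix ι ι ℝ) - A)ᵀ =
      V • vecMulVec e e - W • vecMulVec l l := by
    have h3 : S * (W⁻¹ • vecMulVec c c) * S = W • vecMulVec l l := by
      rw [Matrix.mul_smul, Matrix.smul_mul, mul_vecMulVec, vecMulVec_mul, hSc, hcS,
        smul_vecMulVec, vecMulVec_smul, smul_smul, smul_smul, inv_mul_cancel₀ hW.ne', one_mul]
    rw [h3] at hric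
    have h4 : (z • (1 : Matrix ι ι ℝ) - A) * S + S * ((-z) • (1 : Matrix ι ι ℝ) - A)ᵀ =
        -(A * S + S * Aᵀ) := by
      rw [transpose_sub, transpose_smul, transpose_one, sub_mul, mul_sub, Matrix.smul_mul,
        Matrix.mul_smul, Matrix.one_mul, Matrix.mul_one, neg_smul]
      abel
    rw [h4, neg_eq_iff_add_eq_zero, hric]
    abel
  have h5 : x ⬝ᵥ (((z • (1 : Matrix ι ι ℝ) - A) * S +
      S * ((-z) • (1 : Matrix ι ι ℝ) - A)ᵀ) *ᵥ y) =
      A.charpoly.eval z * (W * (y ⬝ᵥ l)) + A.charpoly.eval (-z) * (W * (x ⬝ᵥ l)) := by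
    rw [add_mulVec, dotProduct_add, ← mulVec_mulVec, ← mulVec_mulVec, mulVec_transpose, h2,
      dotProduct_mulVec, h1, mulVec_smul, hSc, smul_dotProduct, dotProduct_mulVec, hcS,
      dotProduct_smul, dotProduct_smul, smul_dotProduct, dotProduct_comm l y]
    simp only [smul_eq_mul]
  have h6 : x ⬝ᵥ ((V • vecMulVec e e - W • vecMulVec l l) *ᵥ y) =
      V * ((x ⬝ᵥ e) * (y ⬝ᵥ e)) - W * ((x ⬝ᵥ l) * (y ⬝ᵥ l)) := by
    rw [sub_mulVec, dotProduct_sub, smul_mulVec, smul_mulVec, vecMulVec_mulVec, vecMulVec_mulVec,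
      dotProduct_smul, dotProduct_smul, dotProduct_comm e y, dotProduct_comm l y]
    simp only [dotProduct_smul, MulOpposite.smul_eq_mul_unop, MulOpposite.unop_op, smul_eq_mul]
  rw [hE, h6] at h5
  simp only [charpoly_closedLoop, eval_add, eval_numerator]
  rw [← hx, ← hy]
  linear_combination -h5

end Riccati

/-! ### The series connection of plant and delay model. -/

section Augmented

variable {n N : ℕ}

theorem charpoly_augA (A : Matrix (Fin n) (Fin n) ℝ) (c : Fin n → ℝ)
    (AN : Matrix (Fin N) (Fin N) ℝ) (BN : Fin N → ℝ) :
    (augA A c AN BN).charpoly = A.charpoly * AN.charpoly :=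
  charpoly_fromBlocks_zero₁₂ ..

/-- The transfer functions of a series connection multiply. The column `Sum.elim w u` solves the
block triangular system with right side `M.charpoly` times the input, so it is the adjugate applied
to that input. -/
theorem numerator_aug (A : Matrix (Fin n) (Fin n) ℝ) (e c : Fin n → ℝ)
    (AN : Matrix (Fin N) (Fin N) ℝ) (BN CN : Fin N → ℝ) (DN : ℝ) :
    numerator (augA A c AN BN) (augE N e) (augC c CN DN) =
      numerator A e c * (numerator AN BN CN + C DN * AN.charpoly) := by
  set M := augA A c AN BN with hM
  set e' : Fin n → ℝ[X] := fun i => C (e i)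
  set c' : Fin n → ℝ[X] := fun i => C (c i) with hc'
  set b' : Fin N → ℝ[X] := fun i => C (BN i)
  set w : Fin n → ℝ[X] := AN.charpoly • (A.charmatrix.adjugate *ᵥ e') with hw
  set u : Fin N → ℝ[X] := numerator A e c • (AN.charmatrix.adjugate *ᵥ b') with hu
  have hblock : M.charmatrix =
      fromBlocks A.charmatrix 0 (-vecMulVec b' c') AN.charmatrix := by
    rw [hM, augA, charmatrix_fromBlocks]
    congr 1
    · ext; simp
    · ext; simp [vecMulVec_apply, b', c']
  have hdet : M.charpoly = A.charpoly * AN.charpoly := charpoly_augA ..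
  have hE : (fun i => C (augE N e i)) = Sum.elim e' (0 : Fin N → ℝ[X]) := by
    ext1 i; cases i <;> simp [augE, e']
  have hC : (fun i => C (augC c CN DN i)) = Sum.elim (C DN • c') (fun i => C (CN i)) := by
    ext1 i; cases i <;> simp [augC, c']
  have hcw : c' ⬝ᵥ w = AN.charpoly * numerator A e c := by
    rw [hw, dotProduct_smul]; rfl
  have h1 : M.charmatrix *ᵥ Sum.elim w u = M.charpoly • Sum.elim e' (0 : Fin N → ℝ[X]) := by
    rw [hblock, fromBlocks_mulVec]
    ext1 i
    cases i with
    | inl i =>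
      simp only [Sum.elim_comp_inl, Sum.elim_comp_inr, zero_mulVec, add_zero, Sum.elim_inl,
        Pi.smul_apply]
      rw [hw, mulVec_smul, mulVec_mulVec, mul_adjugate, smul_mulVec, one_mulVec, hdet]
      simp only [Pi.smul_apply, smul_eq_mul, charpoly]
      ring
    | inr i =>
      simp only [Sum.elim_comp_inl, Sum.elim_comp_inr, Sum.elim_inr, Pi.smul_apply, neg_mulVec]
      rw [vecMulVec_mulVec, hcw, hu, mulVec_smul, mulVec_mulVec, mul_adjugate, smul_mulVec,
        one_mulVec]
      simp [charpoly]
      ring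
  have h2 : M.charpoly • (M.charmatrix.adjugate *ᵥ Sum.elim e' (0 : Fin N → ℝ[X])) =
      M.charpoly • Sum.elim w u := by
    rw [← mulVec_smul, ← h1, mulVec_mulVec, adjugate_mul, smul_mulVec, one_mulVec, charpoly]
  have h3 : M.charmatrix.adjugate *ᵥ Sum.elim e' (0 : Fin N → ℝ[X]) = Sum.elim w u := by
    ext1 i
    exact mul_left_cancel₀ (charpoly_monic M).ne_zero (congrFun h2 i)
  rw [numerator, hE, hC, h3, dotProduct_block]
  simp only [Sum.elim_comp_inl, Sum.elim_comp_inr]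
  rw [smul_dotProduct, hcw, hu, dotProduct_smul, smul_eq_mul, smul_eq_mul]
  change _ * _ + _ * numerator AN BN CN = _
  ring

end Augmented

/-! ### Padé approximants of a delay are all-pass and stable. -/

section Pade

/-- The numerator and denominator of a diagonal Padé approximant of `exp (-τ s)`. -/
def IsPadePair (N : ℕ) (τ : ℝ) (p q : ℝ[X]) : Prop :=
  p.natDegree ≤ N ∧ q.natDegree ≤ N ∧ q.coeff 0 = 1 ∧
    (PowerSeries.X : PowerSeries ℝ) ^ (2 * N + 1) ∣
      PowerSeries.rescale (-τ) (PowerSeries.exp ℝ) * (q : PowerSeries ℝ) - (p : PowerSeries ℝ)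

theorem rescale_neg_one_coe (p : ℝ[X]) :
    PowerSeries.rescale (-1) (p : PowerSeries ℝ) = ((p.comp (-X) : ℝ[X]) : PowerSeries ℝ) := by
  ext k
  rw [PowerSeries.coeff_rescale, Polynomial.coeff_coe, Polynomial.coeff_coe,
    show (-X : ℝ[X]) = C (-1) * X by simp, comp_C_mul_X_coeff, mul_comm]

theorem natDegree_comp_neg_X (p : ℝ[X]) : (p.comp (-X)).natDegree = p.natDegree := by
  simp [natDegree_comp]

/-- Since exp(-τs) exp(τs) = 1, the difference of the two products is O(s^(2N+1)); as a polynomial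
of degree at most 2N it is zero. -/
theorem IsPadePair.mul_comp_neg_X {N : ℕ} {τ : ℝ} {p q : ℝ[X]} (h : IsPadePair N τ p q) :
    p * p.comp (-X) = q * q.comp (-X) := by
  obtain ⟨hp, hq, -, u, hu⟩ := h
  set S := PowerSeries.rescale (-τ) (PowerSeries.exp ℝ) with hS
  set S' := PowerSeries.rescale (-1) S with hS'
  have hSS : S * S' = 1 := by
    have h1 := congrArg (PowerSeries.rescale (-τ))
      (PowerSeries.exp_mul_exp_neg_eq_one (A := ℝ))
    rw [map_mul, map_one, PowerSeries.evalNegHom, PowerSeries.rescale_rescale] at h1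
    rw [hS', hS, PowerSeries.rescale_rescale, mul_comm (-τ), h1]
  have hu' := congrArg (PowerSeries.rescale (-1)) hu
  rw [map_sub, map_mul, rescale_neg_one_coe, rescale_neg_one_coe, map_mul, map_pow,
    PowerSeries.rescale_X, ← hS', mul_pow] at hu'
  have hdvd : (PowerSeries.X : PowerSeries ℝ) ^ (2 * N + 1) ∣
      ((q * q.comp (-X) - p * p.comp (-X) : ℝ[X]) : PowerSeries ℝ) := by
    refine ⟨u * S' * ((q.comp (-X) : ℝ[X]) : PowerSeries ℝ) +
      (p : PowerSeries ℝ) * (PowerSeries.C (-1) ^ (2 * N + 1) * PowerSeries.rescale (-1) u), ?_⟩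
    push_cast
    linear_combination (S' * ((q.comp (-X) : ℝ[X]) : PowerSeries ℝ)) * hu +
      (p : PowerSeries ℝ) * hu' - ((q : PowerSeries ℝ) * (q.comp (-X) : ℝ[X])) * hSS
  rw [PowerSeries.X_pow_dvd_iff] at hdvd
  rw [eq_comm, ← sub_eq_zero]
  ext k
  rw [coeff_zero]
  by_cases hk : k < 2 * N + 1
  · rw [← Polynomial.coeff_coe]
    exact hdvd k hk
  · apply coeff_eq_zero_of_natDegree_lt
    have h1 : (q * q.comp (-X)).natDegree ≤ 2 * N := by
      refine natDegree_mul_le.trans ?_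
      rw [natDegree_comp_neg_X]; omega
    have h2 : (p * p.comp (-X)).natDegree ≤ 2 * N := by
      refine natDegree_mul_le.trans ?_
      rw [natDegree_comp_neg_X]; omega
    exact lt_of_le_of_lt (natDegree_sub_le_of_le h1 h2) (by simp; omega)

/-- Integration of a complex polynomial over `[0, 1]`. -/
def unitIntegral (f : ℂ[X]) : ℂ := ∫ t in (0 : ℝ)..1, f.eval (t : ℂ)

theorem intervalIntegrable_eval (f : ℂ[X]) :
    IntervalIntegrable (fun t : ℝ => f.eval (t : ℂ)) MeasureTheory.volume 0 1 :=
  (f.continuous.comp Complex.continuous_ofReal).intervalIntegrable _ _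

theorem unitIntegral_add (f g : ℂ[X]) :
    unitIntegral (f + g) = unitIntegral f + unitIntegral g := by
  simp only [unitIntegral, eval_add]
  exact intervalIntegral.integral_add (intervalIntegrable_eval f) (intervalIntegrable_eval g)

theorem unitIntegral_C_mul (r : ℂ) (f : ℂ[X]) :
    unitIntegral (C r * f) = r * unitIntegral f := by
  simp [unitIntegral]

theorem unitIntegral_derivative (f : ℂ[X]) :
    unitIntegral (derivative f) = f.eval 1 - f.eval 0 := by
  have := intervalIntegral.integral_eq_sub_of_hasDerivAt (a := 0) (b := 1)
    (f := fun t : ℝ => f.eval (t : ℂ)) (f' := fun t : ℝ => (derivative f).eval (t : ℂ))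
    (fun x _ => (f.hasDerivAt (x : ℂ)).comp_ofReal) (intervalIntegrable_eval _)
  simpa [unitIntegral] using this

theorem eval_mul_map_conj (w : ℂ[X]) (t : ℝ) :
    (w * w.map (starRingEnd ℂ)).eval (t : ℂ) = (Complex.normSq (w.eval (t : ℂ)) : ℂ) := by
  have : (w.map (starRingEnd ℂ)).eval (t : ℂ) = starRingEnd ℂ (w.eval (t : ℂ)) := by
    conv_lhs => rw [← Complex.conj_ofReal t]
    rw [eval_map, eval₂_hom]
  rw [eval_mul, this, Complex.mul_conj]

theorem unitIntegral_map_conj (f : ℂ[X]) :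
    unitIntegral (f.map (starRingEnd ℂ)) = starRingEnd ℂ (unitIntegral f) := by
  have h : ∀ t : ℝ, (f.map (starRingEnd ℂ)).eval (t : ℂ) = starRingEnd ℂ (f.eval (t : ℂ)) := by
    intro t
    conv_lhs => rw [← Complex.conj_ofReal t]
    rw [eval_map, eval₂_hom]
  simp only [unitIntegral, h, intervalIntegral.integral_of_le zero_le_one]
  exact integral_conj

/-- A polynomial `X w` of degree `N` with `(X w)' - r X w` orthogonal on `[0, 1]` to `w` forces
`0 < Re r`. -/
theorem re_pos_of_unitIntegral_eq_zero (w : ℂ[X]) (hw : w ≠ 0) (r : ℂ)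
    (h : unitIntegral ((derivative (X * w) - C r * (X * w)) * w.map (starRingEnd ℂ)) = 0) :
    0 < r.re := by
  set v := w.map (starRingEnd ℂ) with hv
  have hvv : v.map (starRingEnd ℂ) = w := by
    rw [hv, Polynomial.map_map]
    have : (starRingEnd ℂ).comp (starRingEnd ℂ) = RingHom.id ℂ := by
      ext1 z; simp
    rw [this, Polynomial.map_id]
  have h' : unitIntegral ((derivative (X * v) - C (starRingEnd ℂ r) * (X * v)) * w) = 0 := by
    have := congrArg (starRingEnd ℂ) h
    rw [← unitIntegral_map_conj, map_zero] at this
    rw [← this, Polynomial.map_mul, hvv, Polynomial.map_sub, ← derivative_map]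
    simp [hv]
  -- The hypothesis plus its conjugate, integrated by parts: ∫|w|² + |w(1)|² = 2 Re r ∫ t|w|². The
  -- left side is positive and the last integral is nonnegative.
  have hsum : unitIntegral (w * v) + (w * v).eval 1 =
      (2 * r.re : ℝ) * unitIntegral (X * (w * v)) := by
    have h1 : (w * v).eval 1 = unitIntegral (derivative (X * (w * v))) := by
      rw [unitIntegral_derivative]; simp
    have h2 : ((2 * r.re : ℝ) : ℂ) = r + starRingEnd ℂ r := by
      rw [Complex.add_conj]
    have h3 : w * v + derivative (X * (w * v)) =
        (derivative (X * w) - C r * (X * w)) * v +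
          (derivative (X * v) - C (starRingEnd ℂ r) * (X * v)) * w +
          C (r + starRingEnd ℂ r) * (X * (w * v)) := by
      simp only [derivative_mul, derivative_X, C_add]
      ring
    rw [h1, ← unitIntegral_add, h2, h3, unitIntegral_add, unitIntegral_add, h, h', zero_add,
      zero_add, unitIntegral_C_mul]
  have hI : unitIntegral (w * v) =
      ((∫ t in (0 : ℝ)..1, Complex.normSq (w.eval (t : ℂ)) : ℝ) : ℂ) := by
    rw [unitIntegral, ← intervalIntegral.integral_ofReal]
    simp only [hv, eval_mul_map_conj]
  have hJ : unitIntegral (X * (w * v)) =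
      ((∫ t in (0 : ℝ)..1, t * Complex.normSq (w.eval (t : ℂ)) : ℝ) : ℂ) := by
    rw [unitIntegral, ← intervalIntegral.integral_ofReal]
    refine intervalIntegral.integral_congr fun t _ => ?_
    simp only [hv, eval_mul (p := X), eval_X, eval_mul_map_conj, Complex.ofReal_mul]
  have h1 : (w * v).eval 1 = (Complex.normSq (w.eval 1) : ℂ) := by
    have := eval_mul_map_conj w 1
    rwa [Complex.ofReal_one] at this
  rw [hI, hJ, h1] at hsum
  norm_cast at hsum
  have hcont : Continuous fun t : ℝ => Complex.normSq (w.eval (t : ℂ)) :=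
    Complex.continuous_normSq.comp (w.continuous.comp Complex.continuous_ofReal)
  have hIpos : 0 < ∫ t in (0 : ℝ)..1, Complex.normSq (w.eval (t : ℂ)) := by
    refine intervalIntegral.integral_pos zero_lt_one hcont.continuousOn
      (fun t _ => Complex.normSq_nonneg _) ?_
    by_contra! hcon
    refine hw (eq_zero_of_infinite_isRoot w (Set.Infinite.mono ?_
      ((Set.Icc_infinite (zero_lt_one (α := ℝ))).image Complex.ofReal_injective.injOn)))
    rintro _ ⟨t, ht, rfl⟩
    exact Complex.normSq_eq_zero.1 (le_antisymm (hcon t ht) (Complex.normSq_nonneg _))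
  have hJ0 : 0 ≤ ∫ t in (0 : ℝ)..1, t * Complex.normSq (w.eval (t : ℂ)) :=
    intervalIntegral.integral_nonneg zero_le_one
      fun t ht => mul_nonneg ht.1 (Complex.normSq_nonneg _)
  have h1' := Complex.normSq_nonneg (w.eval 1)
  by_contra! hr
  nlinarith [mul_nonneg (neg_nonneg.2 hr) hJ0]

/-- The iterated antiderivatives `∑ i ≤ k, a i * X ^ (k - i) / (k - i)!`. -/
def antiderivs (a : ℕ → ℂ) (k : ℕ) : ℂ[X] :=
  ∑ i ∈ Finset.range (k + 1), monomial (k - i) (a i / (k - i).factorial)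

theorem derivative_antiderivs_zero (a : ℕ → ℂ) : derivative (antiderivs a 0) = 0 := by
  simp [antiderivs]

theorem derivative_antiderivs_succ (a : ℕ → ℂ) (k : ℕ) :
    derivative (antiderivs a (k + 1)) = antiderivs a k := by
  rw [antiderivs, Finset.sum_range_succ, derivative_add, derivative_sum, antiderivs]
  simp only [Nat.sub_self, derivative_monomial, Nat.cast_zero, mul_zero, map_zero, add_zero]
  refine Finset.sum_congr rfl fun i hi => ?_
  have hi : i ≤ k := Nat.lt_succ_iff.1 (Finset.mem_range.1 hi)
  rw [Nat.succ_sub hi, Nat.succ_sub_one, Nat.factorial_succ]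
  congr 1
  have h1 : ((k - i + 1 : ℕ) : ℂ) ≠ 0 := Nat.cast_ne_zero.2 (Nat.succ_ne_zero _)
  have h2 : ((k - i).factorial : ℂ) ≠ 0 := Nat.cast_ne_zero.2 (Nat.factorial_ne_zero _)
  push_cast at h1 ⊢
  field_simp

theorem eval_zero_antiderivs (a : ℕ → ℂ) (k : ℕ) : (antiderivs a k).eval 0 = a k := by
  rw [antiderivs, eval_finsetSum, Finset.sum_range_succ, Finset.sum_eq_zero]
  · simp
  · intro i hi
    have : k - i ≠ 0 := Nat.sub_ne_zero_of_lt (Finset.mem_range.1 hi)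
    simp [this]

theorem natDegree_antiderivs_le (a : ℕ → ℂ) (k : ℕ) : (antiderivs a k).natDegree ≤ k :=
  natDegree_sum_le_of_forall_le _ _ fun i _ =>
    (natDegree_monomial_le _).trans (Nat.sub_le k i)

theorem coeff_antiderivs_self (a : ℕ → ℂ) (k : ℕ) :
    (antiderivs a k).coeff k = a 0 / k.factorial := by
  rw [antiderivs, finsetSum_coeff, Finset.sum_eq_single 0]
  · simp
  · intro i hi h0
    rw [coeff_monomial, if_neg]
    have := Finset.mem_range.1 hi
    omega
  · simp

/-- Repeated integration by parts, as for Legendre polynomials: each step moves a derivative onto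
`v`, and the boundary terms vanish because the next antiderivative is zero at 0 and at 1. -/
theorem unitIntegral_antiderivs_mul (a : ℕ → ℂ) (K : ℕ) (m : ℕ) :
    ∀ k, k + m ≤ K → (∀ j, k < j → j ≤ K → a j = 0 ∧ (antiderivs a j).eval 1 = 0) →
      ∀ v : ℂ[X], v.degree < m → unitIntegral (antiderivs a k * v) = 0 := by
  induction m with
  | zero =>
    intro k _ _ v hv
    have : v = 0 := by simpa using hv
    simp [this, unitIntegral]
  | succ m ih =>
    intro k hk h v hv
    have h1 := unitIntegral_derivative (antiderivs a (k + 1) * v)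
    have hv' : (derivative v).degree < m := by
      by_cases h0 : v = 0
      · simp [h0]
      · refine lt_of_lt_of_le (degree_derivative_lt h0) ?_
        rw [← natDegree_lt_iff_degree_lt h0] at hv
        exact natDegree_le_iff_degree_le.1 (Nat.le_of_lt_succ hv)
    obtain ⟨h2, h3⟩ := h (k + 1) (by omega) (by omega)
    rw [derivative_mul, unitIntegral_add, derivative_antiderivs_succ,
      ih (k + 1) (by omega) (fun j hj => h j (by omega)) _ hv', eval_mul, eval_mul, h3,
      eval_zero_antiderivs, h2] at h1
    simpa using h1

/-- The Padé conditions of orders N+1 to 2N say that `G N` is orthogonal on [0, 1] to all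
polynomials of degree below N. A root `z` of `q` yields a polynomial `y` with y(0) = 0 and y' - l y
a multiple of `G N`, where l = -τz; testing against y/X forces Re l > 0. -/
theorem IsPadePair.re_neg_of_isRoot {N : ℕ} {τ : ℝ} (hτ : 0 < τ) {p q : ℝ[X]}
    (h : IsPadePair N τ p q) (z : ℂ) (hz : aeval z q = 0) : z.re < 0 := by
  obtain ⟨hp, hq, hq0, hdvd⟩ := h
  have hτ' : (-(τ : ℂ)) ≠ 0 := by simpa using hτ.ne'
  -- The scaling makes (-τ)^j `G j`(1) the coefficient of s^j in exp(-τs) q(s).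
  set a : ℕ → ℂ := fun i => (q.coeff i : ℂ) * ((-(τ : ℂ)) ^ i)⁻¹ with ha
  set G := antiderivs a with hG
  set l : ℂ := -(τ : ℂ) * z with hl
  clear_value l
  have ha0 : a 0 = 1 := by simp [ha, hq0]
  have hane : ∀ j, N < j → a j = 0 := by
    intro j hj
    simp [ha, coeff_eq_zero_of_natDegree_lt (lt_of_le_of_lt hq hj)]
  have hG1 : ∀ j, N < j → j ≤ 2 * N → (G j).eval 1 = 0 := by
    intro j hj hj2
    rw [PowerSeries.X_pow_dvd_iff] at hdvd
    have h1 := hdvd j (by omega)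
    rw [map_sub, Polynomial.coeff_coe, coeff_eq_zero_of_natDegree_lt (lt_of_le_of_lt hp hj),
      sub_zero, mul_comm, PowerSeries.coeff_mul,
      Finset.Nat.sum_antidiagonal_eq_sum_range_succ (fun x y =>
        PowerSeries.coeff x (q : PowerSeries ℝ) *
          PowerSeries.coeff y (PowerSeries.rescale (-τ) (PowerSeries.exp ℝ)))] at h1
    have h2 := congrArg (fun x : ℝ => ((-(τ : ℂ)) ^ j)⁻¹ * (x : ℂ)) h1
    simp only [Complex.ofReal_zero, mul_zero, Complex.ofReal_sum, Finset.mul_sum] at h2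
    rw [← h2, hG, antiderivs, eval_finsetSum]
    refine Finset.sum_congr rfl fun i hi => ?_
    have hi : i ≤ j := Nat.lt_succ_iff.1 (Finset.mem_range.1 hi)
    rw [Polynomial.coeff_coe, PowerSeries.coeff_rescale, PowerSeries.coeff_exp, eval_monomial,
      one_pow, mul_one, ha]
    have h3 : (-(τ : ℂ)) ^ j = (-(τ : ℂ)) ^ i * (-(τ : ℂ)) ^ (j - i) := by
      rw [← pow_add, Nat.add_sub_cancel' hi]
    rw [h3]
    have h4 : ((j - i).factorial : ℂ) ≠ 0 := Nat.cast_ne_zero.2 (Nat.factorial_ne_zero _)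
    push_cast
    field_simp
  have hl0 : l ≠ 0 := by
    rw [hl]
    refine mul_ne_zero hτ' ?_
    rintro rfl
    rw [aeval_def, eval₂_at_zero, hq0] at hz
    simp at hz
  -- Differentiation shifts the index of `G`, so the sum telescopes in y' - l y; its value at 0 is
  -- q(z).
  set y : ℂ[X] := ∑ j ∈ Finset.range (N + 1), C (l ^ j) * G j with hy
  have hy0 : y.eval 0 = 0 := by
    refine Eq.trans ?_ hz
    rw [hy, eval_finsetSum, aeval_eq_sum_range' (Nat.lt_succ_of_le hq)]
    refine Finset.sum_congr rfl fun j _ => ?_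
    rw [eval_mul, eval_C, hG, eval_zero_antiderivs, ha, hl, mul_pow, Complex.real_smul]
    field_simp
  have hde : derivative y - C l * y = -(C (l ^ (N + 1)) * G N) := by
    have h1 : derivative y = ∑ j ∈ Finset.range N, C (l ^ (j + 1)) * G j := by
      rw [hy, Finset.sum_range_succ', derivative_add, derivative_sum]
      simp only [derivative_C_mul, hG, derivative_antiderivs_zero, derivative_antiderivs_succ,
        mul_zero, add_zero]
    rw [h1, hy, Finset.sum_range_succ, mul_add, Finset.mul_sum, pow_succ', C_mul, sub_eq_iff_eq_add]
    simp only [pow_succ', C_mul, mul_assoc]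
    ring
  have hGN : G N ≠ 0 := by
    intro h0
    have h1 := coeff_antiderivs_self a N
    rw [← hG, h0, ha0, coeff_zero, eq_comm, div_eq_zero_iff] at h1
    simp [Nat.factorial_ne_zero] at h1
  obtain ⟨w, hw⟩ : X ∣ y := X_dvd_iff.2 (by rw [coeff_zero_eq_eval_zero, hy0])
  have hyne : y ≠ 0 := by
    intro h0
    rw [h0, derivative_zero, mul_zero, sub_zero, zero_eq_neg] at hde
    exact (mul_ne_zero (C_ne_zero.2 (pow_ne_zero _ hl0)) hGN) hde
  have hwne : w ≠ 0 := by rintro rfl; exact hyne (by rw [hw, mul_zero])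
  have hwdeg : w.degree < N := by
    have h1 : y.natDegree ≤ N := natDegree_sum_le_of_forall_le _ _ fun j hj =>
      (natDegree_C_mul_le _ _).trans ((natDegree_antiderivs_le a j).trans
        (Nat.lt_succ_iff.1 (Finset.mem_range.1 hj)))
    rw [hw, natDegree_X_mul hwne] at h1
    exact (natDegree_lt_iff_degree_lt hwne).1 h1
  have hpos := re_pos_of_unitIntegral_eq_zero w hwne l (by
    rw [← hw, hde, neg_mul, mul_assoc, ← neg_one_mul, ← C_1, ← C_neg, unitIntegral_C_mul,
      unitIntegral_C_mul, unitIntegral_antiderivs_mul a (2 * N) N N (by omega)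
        (fun j hj hj2 => ⟨hane j hj, hG1 j hj hj2⟩) _ (by rwa [degree_map]), mul_zero, mul_zero])
  rw [hl, ← Complex.ofReal_neg, Complex.re_ofReal_mul] at hpos
  nlinarith

end Pade

/-! ### Passage from real to complex matrices. -/

section Complexification

variable {ι : Type*}

/-- A real vector, regarded as a complex one. -/
abbrev complexify (v : ι → ℝ) : ι → ℂ := fun i => (v i : ℂ)

theorem star_complexify (v : ι → ℝ) : star (complexify v) = complexify v := by
  ext1 i; simp [complexify]

theorem conjTranspose_toComplex (A : Matrix ι ι ℝ) : (toComplex A)ᴴ = toComplex Aᵀ := by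
  ext i j; simp [toComplex]

theorem toComplex_vecMulVec (u v : ι → ℝ) :
    toComplex (vecMulVec u v) = vecMulVec (complexify u) (complexify v) := by
  ext i j; simp [toComplex, vecMulVec_apply]

theorem toComplex_sub (A B : Matrix ι ι ℝ) : toComplex (A - B) = toComplex A - toComplex B := by
  ext i j; simp [toComplex]

theorem toComplex_add (A B : Matrix ι ι ℝ) : toComplex (A + B) = toComplex A + toComplex B := by
  ext i j; simp [toComplex]

theorem toComplex_smul (r : ℝ) (A : Matrix ι ι ℝ) :
    toComplex (r • A) = (r : ℂ) • toComplex A := by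
  ext i j; simp [toComplex]

variable [Fintype ι]

theorem toComplex_mul (A B : Matrix ι ι ℝ) : toComplex (A * B) = toComplex A * toComplex B :=
  Matrix.map_mul (f := Complex.ofRealHom)

theorem complexify_mulVec (A : Matrix ι ι ℝ) (v : ι → ℝ) :
    complexify (A *ᵥ v) = toComplex A *ᵥ complexify v :=
  comp_mulVec Complex.ofRealHom A v

theorem re_complexify_dotProduct (c : ι → ℝ) (x : ι → ℂ) :
    (complexify c ⬝ᵥ x).re = c ⬝ᵥ fun i => (x i).re := by
  simp [dotProduct, Complex.re_sum]

theorem im_complexify_dotProduct (c : ι → ℝ) (x : ι → ℂ) :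
    (complexify c ⬝ᵥ x).im = c ⬝ᵥ fun i => (x i).im := by
  simp [dotProduct, Complex.im_sum]

theorem re_dotProduct_toComplex_mulVec_star (S : Matrix ι ι ℝ) (x : ι → ℂ) :
    (x ⬝ᵥ (toComplex S *ᵥ star x)).re =
      (fun i => (x i).re) ⬝ᵥ (S *ᵥ fun i => (x i).re) +
        (fun i => (x i).im) ⬝ᵥ (S *ᵥ fun i => (x i).im) := by
  have h1 : ∀ i, ((toComplex S *ᵥ star x) i).re = (S *ᵥ fun i => (x i).re) i := by
    intro i
    simp [mulVec, dotProduct, Complex.re_sum, toComplex]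
  have h2 : ∀ i, ((toComplex S *ᵥ star x) i).im = -(S *ᵥ fun i => (x i).im) i := by
    intro i
    simp [mulVec, dotProduct, Complex.im_sum, toComplex]
  simp only [dotProduct, Complex.re_sum, Complex.mul_re, h1, h2, ← Finset.sum_add_distrib]
  exact Finset.sum_congr rfl fun i _ => by ring

theorem re_dotProduct_toComplex_mulVec_star_pos (S : Matrix ι ι ℝ) (hS : S.PosDef) (x : ι → ℂ)
    (hx : x ≠ 0) : 0 < (x ⬝ᵥ (toComplex S *ᵥ star x)).re := by
  have hnn : ∀ u : ι → ℝ, 0 ≤ u ⬝ᵥ (S *ᵥ u) := fun u => by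
    simpa using hS.posSemidef.dotProduct_mulVec_nonneg u
  have hp : ∀ u : ι → ℝ, u ≠ 0 → 0 < u ⬝ᵥ (S *ᵥ u) := fun u hu => by
    simpa using hS.dotProduct_mulVec_pos hu
  rw [re_dotProduct_toComplex_mulVec_star]
  by_cases h : (fun i => (x i).re) = 0
  · refine add_pos_of_nonneg_of_pos (hnn _) (hp _ fun h' => hx ?_)
    ext1 i
    exact Complex.ext (congrFun h i) (congrFun h' i)
  · exact add_pos_of_pos_of_nonneg (hp _ h) (hnn _)

variable [DecidableEq ι]

theorem toComplex_pow (A : Matrix ι ι ℝ) (k : ℕ) : toComplex (A ^ k) = toComplex A ^ k :=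
  Matrix.map_pow A Complex.ofRealHom k

theorem toComplex_charpoly (A : Matrix ι ι ℝ) :
    (toComplex A).charpoly = A.charpoly.map (algebraMap ℝ ℂ) :=
  Matrix.charpoly_map A (algebraMap ℝ ℂ)

theorem aeval_toComplex (A : Matrix ι ι ℝ) (f : ℝ[X]) :
    aeval (toComplex A) (f.map (algebraMap ℝ ℂ)) = toComplex (aeval A f) := by
  rw [aeval_map_algebraMap]
  exact aeval_algHom_apply (Algebra.ofId ℝ ℂ).mapMatrix A f

theorem mem_spectrum_toComplex_iff (A : Matrix ι ι ℝ) (z : ℂ) :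
    z ∈ spectrum ℂ (toComplex A) ↔ aeval z A.charpoly = 0 := by
  rw [mem_spectrum_iff_isRoot_charpoly, toComplex_charpoly, IsRoot, eval_map_algebraMap]

theorem IsObservable.complexify {A : Matrix ι ι ℝ} {c : ι → ℝ} (h : IsObservable A c)
    (x : ι → ℂ) (hx : ∀ k : ℕ, DelayEstimator.complexify c ⬝ᵥ ((toComplex A ^ k) *ᵥ x) = 0) :
    x = 0 := by
  have hre : (fun i => (x i).re) = 0 := by
    refine h _ fun k => ?_
    have := congrArg Complex.re (hx k)
    rw [re_complexify_dotProduct, ← toComplex_pow] at this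
    rw [← Complex.zero_re, ← this]
    congr 1
    ext1 i
    simp [mulVec, dotProduct, Complex.re_sum, toComplex]
  have him : (fun i => (x i).im) = 0 := by
    refine h _ fun k => ?_
    have := congrArg Complex.im (hx k)
    rw [im_complexify_dotProduct, ← toComplex_pow] at this
    rw [← Complex.zero_im, ← this]
    congr 1
    ext1 i
    simp [mulVec, dotProduct, Complex.im_sum, toComplex]
  ext1 i
  exact Complex.ext (congrFun hre i) (congrFun him i)

end Complexification

/-! ### Stability of the estimator by a Lyapunov argument. -/

section Stability

variable {ι : Type*} [Fintype ι]

theorem toComplex_riccati {A S : Matrix ι ι ℝ} {e c : ι → ℝ} {V W : ℝ} (hW : 0 < W)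
    (hS : IsPosDefRiccatiSolution A e c V W S) :
    toComplex A * toComplex S + toComplex S * (toComplex A)ᵀ +
      (V : ℂ) • vecMulVec (complexify e) (complexify e) =
      (W : ℂ) • vecMulVec (complexify (estimatorGain S c W))
        (complexify (estimatorGain S c W)) := by
  obtain ⟨hpos, hric⟩ := hS
  have hsymm : Sᵀ = S := by simpa using hpos.1.eq
  set l := estimatorGain S c W with hl
  have hSc : S *ᵥ c = W • l := by
    rw [hl, estimatorGain, smul_smul, mul_inv_cancel₀ hW.ne', one_smul]
  have hcS : c ᵥ* S = W • l := by rw [← hsymm, vecMul_transpose, hSc]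
  have h3 : S * (W⁻¹ • vecMulVec c c) * S = W • vecMulVec l l := by
    rw [Matrix.mul_smul, Matrix.smul_mul, mul_vecMulVec, vecMulVec_mul, hSc, hcS,
      smul_vecMulVec, vecMulVec_smul, smul_smul, smul_smul, inv_mul_cancel₀ hW.ne', one_mul]
  rw [h3, eq_comm, sub_eq_zero] at hric
  have := congrArg toComplex hric
  rwa [toComplex_smul, toComplex_vecMulVec, toComplex_add, toComplex_add, toComplex_smul,
    toComplex_vecMulVec, toComplex_mul, toComplex_mul] at this

variable [DecidableEq ι]

/-- The estimator of a positive definite solution of the Riccati equation is asymptotically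
stable. -/
theorem re_neg_of_isRoot_charpoly_closedLoop {A S : Matrix ι ι ℝ} {e c : ι → ℝ} {V W : ℝ}
    (hV : 0 ≤ V) (hW : 0 < W) (hobs : IsObservable A c)
    (hS : IsPosDefRiccatiSolution A e c V W S) (z : ℂ)
    (hz : aeval z (closedLoop A (estimatorGain S c W) c).charpoly = 0) : z.re < 0 := by
  have hric := toComplex_riccati hW hS
  have hpos := hS.1
  have hsymm : Sᵀ = S := by simpa using hpos.1.eq
  set l := estimatorGain S c W with hl
  have hSc : S *ᵥ c = W • l := by
    rw [hl, estimatorGain, smul_smul, mul_inv_cancel₀ hW.ne', one_smul]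
  obtain ⟨x, hx0, hx⟩ : ∃ x : ι → ℂ, x ≠ 0 ∧
      x ᵥ* (scalar ι z - toComplex (closedLoop A l c)) = 0 := by
    rw [exists_vecMul_eq_zero_iff, ← Matrix.eval_charpoly, toComplex_charpoly,
      eval_map_algebraMap, hz]
  set M := toComplex A
  set T := toComplex S
  set cc := complexify c
  set lc := complexify l
  set ec := complexify e
  set α := x ⬝ᵥ lc
  have hTt : Tᵀ = T := by
    have := congrArg toComplex hsymm
    exact this
  have hMstar : ∀ v : ι → ℂ, star (v ᵥ* M) = Mᵀ *ᵥ star v := by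
    intro v
    rw [star_vecMul, conjTranspose_toComplex]; rfl
  have hxM : x ᵥ* M = z • x + α • cc := by
    rw [closedLoop, toComplex_sub, toComplex_vecMulVec, vecMul_sub, vecMul_sub, scalar_apply,
      ← smul_one_eq_diagonal, vecMul_smul, vecMul_one, vecMul_vecMulVec] at hx
    have : x ᵥ* M = z • x + (x ⬝ᵥ complexify l) • complexify c -
      (z • x - (x ᵥ* toComplex A - (x ⬝ᵥ complexify l) • complexify c)) := by abel
    rw [this, hx, sub_zero]
  have hTc : T *ᵥ cc = (W : ℂ) • lc := by
    have : complexify (W • l) = (W : ℂ) • lc := by ext1 i; simp [lc, complexify]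
    rw [← this, ← hSc, complexify_mulVec]
  set y := T *ᵥ star x with hy
  set β := x ⬝ᵥ y with hβ
  have hαstar : lc ⬝ᵥ star x = star α :=
    (congrArg (· ⬝ᵥ star x) (star_complexify l).symm).trans (star_dotProduct_star lc x)
  have hcy : cc ⬝ᵥ y = W * star α := by
    rw [hy, dotProduct_mulVec, ← mulVec_transpose, hTt, hTc, smul_dotProduct, hαstar, smul_eq_mul]
  have hxT : x ᵥ* T = star y := by
    rw [hy, star_mulVec, star_star, conjTranspose_toComplex, hsymm]
  have hxMstar : Mᵀ *ᵥ star x = star z • star x + star α • cc := by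
    rw [← hMstar, hxM, star_add, star_smul, star_smul, star_complexify]
  have hestar : ec ⬝ᵥ star x = star (x ⬝ᵥ ec) :=
    (congrArg (· ⬝ᵥ star x) (star_complexify e).symm).trans (star_dotProduct_star ec x)
  have hβpos : 0 < β.re := re_dotProduct_toComplex_mulVec_star_pos S hpos x hx0
  have hxMy : (x ᵥ* M) ⬝ᵥ y = z * β + W * (α * star α) := by
    rw [hxM, add_dotProduct, smul_dotProduct, smul_dotProduct, hcy, smul_eq_mul, smul_eq_mul]
    ring
  have hβstar : star β = β := by
    rw [hβ, ← star_dotProduct_star, ← hxT, ← dotProduct_mulVec]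
  have hmain : ((x ᵥ* M) ⬝ᵥ y) + star ((x ᵥ* M) ⬝ᵥ y) + V * ((x ⬝ᵥ ec) * star (x ⬝ᵥ ec)) =
      W * (α * star α) := by
    have := congrArg (fun B => x ⬝ᵥ (B *ᵥ star x)) hric
    simp only [add_mulVec, smul_mulVec, ← mulVec_mulVec, vecMulVec_mulVec, dotProduct_add,
      dotProduct_smul, op_smul_eq_smul, smul_eq_mul] at this
    have h1 : x ⬝ᵥ (M *ᵥ y) = (x ᵥ* M) ⬝ᵥ y := dotProduct_mulVec ..
    have h2 : x ⬝ᵥ (T *ᵥ (Mᵀ *ᵥ star x)) = star ((x ᵥ* M) ⬝ᵥ y) := by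
      rw [dotProduct_mulVec, hxT, ← hMstar, star_dotProduct_star]
    rw [h1, h2, hestar, hαstar] at this
    linear_combination this
  rw [hxMy] at hmain
  -- The Riccati equation evaluated on the left eigenvector `x` of the closed loop. If Re z ≥ 0, all
  -- three terms must vanish.
  have hre : 2 * (z.re * β.re) + W * Complex.normSq α + V * Complex.normSq (x ⬝ᵥ ec) = 0 := by
    have hβim : β.im = 0 := Complex.conj_eq_iff_im.1 hβstar
    have h1 := congrArg Complex.re hmain
    simp only [Complex.star_def, Complex.mul_conj] at h1
    simp [Complex.mul_re, hβim] at h1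
    linarith
  by_contra! hzre
  have h1 : 0 ≤ z.re * β.re := mul_nonneg hzre hβpos.le
  have h2 : 0 ≤ W * Complex.normSq α := mul_nonneg hW.le (Complex.normSq_nonneg _)
  have h3 : 0 ≤ V * Complex.normSq (x ⬝ᵥ ec) := mul_nonneg hV (Complex.normSq_nonneg _)
  have hα : α = 0 := by
    have : W * Complex.normSq α = 0 := by linarith
    simpa [hW.ne'] using this
  have hVe : (V : ℂ) * star (x ⬝ᵥ ec) = 0 := by
    have : V * Complex.normSq (x ⬝ᵥ ec) = 0 := by linarith
    rcases mul_eq_zero.1 this with h | h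
    · simp [h]
    · simp [Complex.normSq_eq_zero.1 h]
  -- With these terms gone, `y` is an eigenvector of `A` invisible to `c` unless it is zero;
  -- observability makes it zero, against `hβpos`.
  have hMy : M *ᵥ y = -star z • y := by
    have := congrArg (fun B => B *ᵥ star x) hric
    simp only [add_mulVec, smul_mulVec, ← mulVec_mulVec, vecMulVec_mulVec, op_smul_eq_smul] at this
    rw [hestar, hαstar, smul_smul, smul_smul, hVe, hα, star_zero, mul_zero, zero_smul, zero_smul,
      add_zero, hxMstar, hα, star_zero, zero_smul, add_zero, mulVec_smul] at this
    rw [neg_smul]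
    exact eq_neg_of_add_eq_zero_left this
  have hy0 : y = 0 := by
    refine hobs.complexify y fun k => ?_
    have hk : (M ^ k) *ᵥ y = (-star z) ^ k • y := by
      induction k with
      | zero => simp
      | succ k ih => rw [pow_succ', ← mulVec_mulVec, ih, mulVec_smul, hMy, smul_smul, pow_succ]
    rw [hk, dotProduct_smul, hcy, hα]
    simp
  rw [hβ, hy0, dotProduct_zero] at hβpos
  exact lt_irrefl _ hβpos

end Stability

/-! ### Observability as injectivity on polynomials of low degree. -/

section Observable

variable {ι : Type*} [Fintype ι] [DecidableEq ι] {K : Type*} [Field K]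

/-- A nonzero `f` of degree d would give a recurrence of order d for the outputs c Mᵏ x. By
dimension some `x ≠ 0` has its first d outputs zero, hence all of them. -/
theorem vecMul_aeval_injective_of_observable (M : Matrix ι ι K) (c : ι → K)
    (hobs : ∀ x : ι → K, (∀ k : ℕ, c ⬝ᵥ ((M ^ k) *ᵥ x) = 0) → x = 0) (f : K[X])
    (hdeg : f.natDegree < Fintype.card ι) (hf : c ᵥ* aeval M f = 0) : f = 0 := by
  by_contra hf0
  let T : (ι → K) →ₗ[K] (Fin f.natDegree → K) :=
    { toFun := fun x j => c ⬝ᵥ ((M ^ (j : ℕ)) *ᵥ x)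
      map_add' := fun x y => by ext1 j; simp [mulVec_add, dotProduct_add]
      map_smul' := fun r x => by ext1 j; simp [mulVec_smul, dotProduct_smul] }
  have hker : LinearMap.ker T ≠ ⊥ :=
    LinearMap.ker_ne_bot_of_finrank_lt (by simpa using hdeg)
  obtain ⟨x, hx, hx0⟩ := Submodule.exists_mem_ne_zero_of_ne_bot hker
  refine hx0 (hobs x fun k => ?_)
  induction k using Nat.strong_induction_on with
  | _ k ih =>
    by_cases hk : k < f.natDegree
    · exact congrFun (LinearMap.mem_ker.1 hx) ⟨k, hk⟩
    · push Not at hk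
      have h1 : (c ᵥ* aeval M f) ⬝ᵥ ((M ^ (k - f.natDegree)) *ᵥ x) = 0 := by
        rw [hf, zero_dotProduct]
      have h2 : ∀ j ≤ f.natDegree, j + (k - f.natDegree) = k - (f.natDegree - j) := by
        intro j hj; omega
      rw [← dotProduct_mulVec, mulVec_mulVec, aeval_eq_sum_range, Finset.sum_mul, sum_mulVec,
        dotProduct_sum, Finset.sum_range_succ, Finset.sum_eq_zero, zero_add, smul_mul_assoc,
        ← pow_add, smul_mulVec, dotProduct_smul, Nat.add_sub_cancel' hk] at h1
      · exact (smul_eq_zero.1 h1).resolve_left (leadingCoeff_ne_zero.2 hf0)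
      · intro j hj
        have hj := Finset.mem_range.1 hj
        rw [smul_mul_assoc, ← pow_add, smul_mulVec, dotProduct_smul, ih _ (by omega), smul_zero]

end Observable

/-! ### Uncontrollable eigenvalues and their multiplicity. -/

section Uncontrollable

variable {ι : Type*} [Fintype ι] [DecidableEq ι]

theorem vecMul_aeval_mem_uncontrollableSubspace (A : Matrix ι ι ℝ) (b : ι → ℝ) (a : ℝ[X])
    (ha : aeval A a *ᵥ b = 0) (c : ι → ℂ) (h : ℂ[X]) :
    c ᵥ* aeval (toComplex A) (a.map (algebraMap ℝ ℂ) * h) ∈ uncontrollableSubspace A b := by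
  intro k
  have hb : aeval (toComplex A) (a.map (algebraMap ℝ ℂ)) *ᵥ complexify b = 0 := by
    rw [aeval_toComplex, ← complexify_mulVec, ha]
    ext1 i; simp [complexify]
  have hX : toComplex A ^ k = aeval (toComplex A) (X ^ k : ℂ[X]) := by simp
  have hcomm : a.map (algebraMap ℝ ℂ) * h * X ^ k = h * X ^ k * a.map (algebraMap ℝ ℂ) := by ring
  change _ ⬝ᵥ (_ *ᵥ complexify b) = 0
  rw [← dotProduct_mulVec, mulVec_mulVec, hX, ← map_mul, hcomm, map_mul, ← mulVec_mulVec, hb,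
    mulVec_zero, dotProduct_zero]

theorem toLin_transpose_sub_pow_apply (M : Matrix ι ι ℂ) (μ : ℂ) (k : ℕ) (x : ι → ℂ) :
    ((toLin' Mᵀ - μ • (1 : Module.End ℂ (ι → ℂ))) ^ k) x =
      x ᵥ* aeval M ((X - C μ) ^ k : ℂ[X]) := by
  induction k generalizing x with
  | zero => simp
  | succ k ih =>
    rw [pow_succ, Module.End.mul_apply, ih, pow_succ', map_mul, ← vecMul_vecMul]
    congr 1
    simp [vecMul_sub, mulVec_transpose, Algebra.algebraMap_eq_smul_one, vecMul_smul]

theorem vecMul_aeval_charpoly_mul (M : Matrix ι ι ℂ) (c : ι → ℂ) (f : ℂ[X]) :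
    c ᵥ* aeval M (M.charpoly * f) = 0 := by
  rw [map_mul, aeval_self_charpoly, zero_mul, vecMul_zero]

/-- If `χ_A = a g` and `a(A) b = 0`, then the roots of `g` are uncontrollable eigenvalues. -/
theorem isUncontrollableEigenvalue_of_charpoly_eq_mul (A : Matrix ι ι ℝ) (b c : ι → ℝ)
    (hobs : IsObservable A c) (a g : ℝ[X]) (hχ : A.charpoly = a * g)
    (ha : aeval A a *ᵥ b = 0) (μ : ℂ) (hμ : (g.map (algebraMap ℝ ℂ)).IsRoot μ) :
    IsUncontrollableEigenvalue A b μ := by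
  have hχ' : (toComplex A).charpoly = a.map (algebraMap ℝ ℂ) * g.map (algebraMap ℝ ℂ) := by
    rw [toComplex_charpoly, hχ, Polynomial.map_mul]
  obtain ⟨s, hs⟩ := dvd_iff_isRoot.2 hμ
  have hne : a.map (algebraMap ℝ ℂ) * s ≠ 0 := by
    intro h0
    refine (charpoly_monic (toComplex A)).ne_zero ?_
    rw [hχ', hs, mul_left_comm, h0, mul_zero]
  have hcard : (a.map (algebraMap ℝ ℂ) * s).natDegree < Fintype.card ι := by
    have h1 := charpoly_natDegree_eq_dim (toComplex A)
    rw [hχ', hs, mul_left_comm, natDegree_mul (X_sub_C_ne_zero μ) hne, natDegree_X_sub_C] at h1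
    omega
  -- The left eigenvector is c a(A) s(A) with g = (X - μ)s: Cayley–Hamilton gives the eigenvalue
  -- equation, and the degree of `a s` is too small for it to vanish.
  refine ⟨complexify c ᵥ* aeval (toComplex A) (a.map (algebraMap ℝ ℂ) * s), fun h0 => hne ?_,
    ?_, ?_⟩
  · exact vecMul_aeval_injective_of_observable _ _ hobs.complexify _ hcard h0
  · have h1 := vecMul_aeval_charpoly_mul (toComplex A) (complexify c) 1
    have h2 : (toComplex A).charpoly * 1 = a.map (algebraMap ℝ ℂ) * s * (X - C μ) := by
      rw [hχ', hs]; ring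
    rw [h2, map_mul, ← vecMul_vecMul, map_sub, aeval_X, aeval_C, vecMul_sub,
      Algebra.algebraMap_eq_smul_one, vecMul_smul, vecMul_one, sub_eq_zero] at h1
    exact h1
  · simpa using vecMul_aeval_mem_uncontrollableSubspace A b a ha (complexify c) s 0

/-- With g = (X - μ)^m r, the rows c a(A) r(A) f(A), deg f < m, form an m-dimensional space of
generalized left eigenvectors that annihilate the reachable subspace. -/
theorem rootMultiplicity_le_uncontrollableMultiplicity (A : Matrix ι ι ℝ) (b c : ι → ℝ)
    (hobs : IsObservable A c) (a g : ℝ[X]) (hχ : A.charpoly = a * g)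
    (ha : aeval A a *ᵥ b = 0) (μ : ℂ) :
    (g.map (algebraMap ℝ ℂ)).rootMultiplicity μ ≤ uncontrollableMultiplicity A b μ := by
  set a' := a.map (algebraMap ℝ ℂ)
  set g' := g.map (algebraMap ℝ ℂ)
  set m := g'.rootMultiplicity μ
  have hχ' : (toComplex A).charpoly = a' * g' := by
    rw [toComplex_charpoly, hχ, Polynomial.map_mul]
  have hne : a' * g' ≠ 0 := hχ' ▸ (charpoly_monic (toComplex A)).ne_zero
  obtain ⟨r, hr, -⟩ := exists_eq_pow_rootMultiplicity_mul_and_not_dvd g'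
    (right_ne_zero_of_mul hne) μ
  change g' = (X - C μ) ^ m * r at hr
  have hne' : a' * r ≠ 0 := by
    rw [hr, mul_left_comm] at hne
    exact right_ne_zero_of_mul hne
  have hcard : m + (a' * r).natDegree = Fintype.card ι := by
    rw [← charpoly_natDegree_eq_dim (toComplex A), hχ', hr, mul_left_comm,
      natDegree_mul (pow_ne_zero _ (X_sub_C_ne_zero μ)) hne', natDegree_pow, natDegree_X_sub_C,
      mul_one]
  let Θ : degreeLT ℂ m →ₗ[ℂ] (ι → ℂ) :=
    { toFun := fun f => complexify c ᵥ* aeval (toComplex A) (a' * (r * f.1))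
      map_add' := fun f f' => by
        simp only [Submodule.coe_add, mul_add, map_add, vecMul_add]
      map_smul' := fun s f => by
        simp only [Submodule.coe_smul, mul_smul_comm, map_smul, vecMul_smul, RingHom.id_apply] }
  have hmem : ∀ f, Θ f ∈ uncontrollableSubspace A b ⊓
      Module.End.maxGenEigenspace (toLin' (toComplex A)ᵀ) μ := by
    intro f
    refine ⟨vecMul_aeval_mem_uncontrollableSubspace A b a ha (complexify c) _, ?_⟩
    refine (Module.End.mem_maxGenEigenspace _ _ _).2 ⟨m, ?_⟩
    rw [toLin_transpose_sub_pow_apply]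
    change (complexify c ᵥ* aeval (toComplex A) (a' * (r * f.1))) ᵥ* _ = 0
    rw [vecMul_vecMul, ← map_mul]
    have : a' * (r * f.1) * (X - C μ) ^ m = (toComplex A).charpoly * f.1 := by
      rw [hχ', hr]; ring
    rw [this, vecMul_aeval_charpoly_mul]
  have hinj : Function.Injective (Θ.codRestrict _ hmem) := by
    rw [← LinearMap.ker_eq_bot, LinearMap.ker_codRestrict, LinearMap.ker_eq_bot']
    rintro ⟨f, hf⟩ h0
    rw [mem_degreeLT] at hf
    change complexify c ᵥ* aeval (toComplex A) (a' * (r * f)) = 0 at h0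
    by_contra hf0
    have hf0 : f ≠ 0 := fun h => hf0 (Subtype.ext h)
    refine mul_ne_zero hne' hf0 ?_
    rw [← mul_assoc] at h0
    refine vecMul_aeval_injective_of_observable _ _ hobs.complexify _ ?_ h0
    rw [natDegree_mul hne' hf0, ← hcard, add_comm]
    have := (natDegree_lt_iff_degree_lt hf0).2 hf
    omega
  have := LinearMap.finrank_le_finrank_of_injective hinj
  rwa [(degreeLTEquiv ℂ m).finrank_eq, Module.finrank_fin_fun] at this

end Uncontrollable

/-! ### Coprimeness and minimal realizations. -/

section Minimality

variable {n : ℕ}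

theorem one_add_transferFunction {ι : Type*} [Fintype ι] [DecidableEq ι] (A : Matrix ι ι ℝ)
    (b c : ι → ℝ) :
    1 + transferFunction A b c 0 = algebraMap ℝ[X] (RatFunc ℝ) (closedLoop A b c).charpoly /
      algebraMap ℝ[X] (RatFunc ℝ) A.charpoly := by
  have h := RatFunc.algebraMap_ne_zero (charpoly_monic A).ne_zero
  rw [transferFunction_eq, charpoly_closedLoop, map_zero, add_zero, map_add, add_div, div_self h]

theorem isCoprime_charpoly_of_disjoint_spectrum {ι κ : Type*} [Fintype ι] [DecidableEq ι]
    [Fintype κ] [DecidableEq κ] (A : Matrix ι ι ℝ) (B : Matrix κ κ ℝ)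
    (h : Disjoint (spectrum ℂ (toComplex A)) (spectrum ℂ (toComplex B))) :
    IsCoprime A.charpoly B.charpoly := by
  rw [isCoprime_iff_aeval_ne_zero_of_isAlgClosed ℝ ℂ]
  intro z
  by_contra! hz
  exact Set.disjoint_left.1 h ((mem_spectrum_toComplex_iff A z).2 hz.1)
    ((mem_spectrum_toComplex_iff B z).2 hz.2)

theorem isMinimalRealization_of_isCoprime (A : Matrix (Fin n) (Fin n) ℝ) (b c : Fin n → ℝ)
    (d : ℝ) (h : IsCoprime A.charpoly (numerator A b c)) :
    IsMinimalRealization A b c d (transferFunction A b c d) := by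
  refine ⟨rfl, fun m A' b' c' d' heq => ?_⟩
  have h1 := RatFunc.algebraMap_ne_zero (charpoly_monic A).ne_zero
  have h2 := RatFunc.algebraMap_ne_zero (charpoly_monic A').ne_zero
  rw [transferFunction_eq, transferFunction_eq, ← RatFunc.algebraMap_C, ← RatFunc.algebraMap_C]
    at heq
  have hdvd : A.charpoly ∣ A'.charpoly * numerator A b c := by
    refine ⟨numerator A' b' c' + (C d' - C d) * A'.charpoly, RatFunc.algebraMap_injective ℝ ?_⟩
    simp only [map_mul, map_add, map_sub]
    field_simp at heq
    linear_combination -heq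
  have := natDegree_le_of_dvd (h.dvd_of_dvd_mul_right hdvd) (charpoly_monic A').ne_zero
  simpa [charpoly_natDegree_eq_dim] using this

end Minimality

/-! ### Properties the delay model inherits, and uniqueness of spectral factors. -/

section DelayModel

variable {n N : ℕ}

theorem isObservable_of_isObservable_aug {A : Matrix (Fin n) (Fin n) ℝ} {c : Fin n → ℝ}
    {AN : Matrix (Fin N) (Fin N) ℝ} {BN CN : Fin N → ℝ} {DN : ℝ}
    (h : IsObservable (augA A c AN BN) (augC c CN DN)) : IsObservable AN CN := by
  intro x hx
  have hpow : ∀ k : ℕ, (augA A c AN BN ^ k) *ᵥ Sum.elim (0 : Fin n → ℝ) x =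
      Sum.elim (0 : Fin n → ℝ) ((AN ^ k) *ᵥ x) := by
    intro k
    induction k with
    | zero => simp
    | succ k ih =>
      rw [pow_succ', ← mulVec_mulVec, ih, augA, fromBlocks_mulVec]
      simp [pow_succ', mulVec_mulVec]
  have h0 := h (Sum.elim 0 x) fun k => by
    rw [hpow, augC, dotProduct_block]
    simpa using hx k
  ext1 i
  exact congrFun h0 (Sum.inr i)

/-- The delay states start at zero and are driven only through `BN`, so `aeval AN f` kills the delay
component of every reachable state; controllability makes these components fill the space. -/
theorem eq_zero_of_isControllable_aug {A : Matrix (Fin n) (Fin n) ℝ} {c e : Fin n → ℝ}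
    {AN : Matrix (Fin N) (Fin N) ℝ} {BN : Fin N → ℝ}
    (h : IsControllable (augA A c AN BN) (augE N e)) (f : ℝ[X])
    (hf : aeval AN f *ᵥ BN = 0) : aeval AN f = 0 := by
  let T : (Fin n ⊕ Fin N → ℝ) →ₗ[ℝ] (Fin N → ℝ) :=
    (toLin' (aeval AN f)).comp (LinearMap.funLeft ℝ ℝ Sum.inr)
  have hT : ∀ v, T v = aeval AN f *ᵥ (v ∘ Sum.inr) := fun v => rfl
  have hcomm : aeval AN f * AN = AN * aeval AN f := by
    have := congrArg (aeval AN) (mul_comm f X)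
    simpa using this
  have hspan : Submodule.span ℝ (Set.range fun k : ℕ => (augA A c AN BN ^ k) *ᵥ augE N e) ≤
      LinearMap.ker T := by
    rw [Submodule.span_le]
    rintro _ ⟨k, rfl⟩
    simp only [SetLike.mem_coe, LinearMap.mem_ker]
    induction k with
    | zero =>
      rw [hT]
      have : ((augA A c AN BN ^ 0) *ᵥ augE N e) ∘ Sum.inr = 0 := by
        ext1 i; simp [augE]
      rw [this, mulVec_zero]
    | succ k ih =>
      rw [hT] at ih ⊢
      rw [pow_succ', ← mulVec_mulVec]
      nth_rewrite 1 [augA]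
      rw [fromBlocks_mulVec, Sum.elim_comp_inr, mulVec_add, vecMulVec_mulVec, mulVec_smul, hf,
        smul_zero, zero_add, mulVec_mulVec, hcomm, ← mulVec_mulVec, ih, mulVec_zero]
  rw [show Submodule.span ℝ _ = ⊤ from h, top_le_iff] at hspan
  apply Matrix.toLin'.injective
  rw [map_zero]
  refine LinearMap.ext fun v => ?_
  have h1 : T (Sum.elim 0 v) = 0 := LinearMap.mem_ker.1 (hspan ▸ Submodule.mem_top)
  exact h1

theorem aeval_eq_zero_of_mem_spectrum {ι : Type*} [Fintype ι] [DecidableEq ι] (A : Matrix ι ι ℝ)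
    (f : ℝ[X]) (hf : aeval A f = 0) (z : ℂ) (hz : z ∈ spectrum ℂ (toComplex A)) :
    aeval z f = 0 := by
  have h1 := spectrum.subset_polynomial_aeval (toComplex A) (f.map (algebraMap ℝ ℂ))
    ⟨z, hz, rfl⟩
  simp only [eval_map_algebraMap] at h1
  rw [aeval_toComplex, hf] at h1
  by_contra hne
  refine spectrum.mem_iff.1 h1 ?_
  have : toComplex (0 : Matrix ι ι ℝ) = 0 := by ext; simp [toComplex]
  rw [this, sub_zero]
  exact (isUnit_iff_ne_zero.2 hne).map (algebraMap ℂ (Matrix ι ι ℂ))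

theorem charpoly_mul_eq_of_transferFunction_eq_div {ι : Type*} [Fintype ι] [DecidableEq ι]
    {A : Matrix ι ι ℝ} {b c : ι → ℝ} {d : ℝ} {p q : ℝ[X]} (hq : q ≠ 0)
    (h : transferFunction A b c d =
      algebraMap ℝ[X] (RatFunc ℝ) p / algebraMap ℝ[X] (RatFunc ℝ) q) :
    p * A.charpoly = q * (numerator A b c + C d * A.charpoly) := by
  have h1 := RatFunc.algebraMap_ne_zero (charpoly_monic A).ne_zero
  have h2 := RatFunc.algebraMap_ne_zero hq
  rw [transferFunction_eq, ← RatFunc.algebraMap_C] at h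
  apply RatFunc.algebraMap_injective ℝ
  simp only [map_mul, map_add]
  field_simp at h
  linear_combination -h

theorem aeval_comp_neg_X (f : ℝ[X]) (z : ℂ) : aeval z (f.comp (-X)) = aeval (-z) f := by
  rw [aeval_comp]; simp

/-- Two monic polynomials without roots in the closed right half plane agree when their
products with their reflections do. -/
theorem eq_of_mul_comp_neg_X_eq {f g : ℝ[X]} (hf : f.Monic) (hg : g.Monic)
    (hf' : ∀ z : ℂ, aeval z f = 0 → z.re < 0) (hg' : ∀ z : ℂ, aeval z g = 0 → z.re < 0)
    (h : f * f.comp (-X) = g * g.comp (-X)) : f = g := by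
  have key : ∀ {f g : ℝ[X]}, (∀ z : ℂ, aeval z f = 0 → z.re < 0) →
      (∀ z : ℂ, aeval z g = 0 → z.re < 0) → f * f.comp (-X) = g * g.comp (-X) → f ∣ g := by
    intro f g hf' hg' h
    -- The roots of `f` lie in the left half plane and those of the reflected `g` in the right one,
    -- so these two are coprime.
    refine IsCoprime.dvd_of_dvd_mul_right ?_ (Dvd.intro _ h)
    rw [isCoprime_iff_aeval_ne_zero_of_isAlgClosed ℝ ℂ]
    intro z
    by_contra! hz
    rw [aeval_comp_neg_X] at hz
    have h1 := hf' z hz.1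
    have h2 := hg' _ hz.2
    rw [Complex.neg_re] at h2
    linarith
  exact eq_of_monic_of_associated hf hg (associated_of_dvd_dvd (key hf' hg' h) (key hg' hf' h.symm))

end DelayModel

end DelayEstimator

end

/-! ### Assembly of the main theorem. -/

open DelayEstimator in
theorem mainTheorem2
    -- the plant `x' = A x + E d`, `y = C x`, and the noise covariances
    {n : ℕ} (A : Matrix (Fin n) (Fin n) ℝ) (E C : Fin n → ℝ) (V W : ℝ)
    (hAC : IsObservable A C) (hAE : IsControllable A E) (hV : 0 ≤ V) (hW : 0 < W)
    -- the Riccati equation of the plant without delay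
    (S : Matrix (Fin n) (Fin n) ℝ) (hS : IsPosDefRiccatiSolution A E C V W S)
    -- the delay and a minimal realization of its `N`-th order Padé approximant
    (N : ℕ) (τ : ℝ) (hτ : 0 < τ) (P : RatFunc ℝ) (hP : IsPadeDelay N τ P)
    (AN : Matrix (Fin N) (Fin N) ℝ) (BN CN : Fin N → ℝ) (DN : ℝ)
    (hmin : IsMinimalRealization AN BN CN DN P)
    -- the augmented system and its Riccati equation
    (hobs : IsObservable (augA A C AN BN) (augC C CN DN))
    (hctr : IsControllable (augA A C AN BN) (augE N E))
    (Saug : Matrix (Fin n ⊕ Fin N) (Fin n ⊕ Fin N) ℝ)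
    (hSaug : IsPosDefRiccatiSolution (augA A C AN BN) (augE N E) (augC C CN DN) V W Saug)
    -- the optimal gains, with and without the delay model
    (Laug : Fin n ⊕ Fin N → ℝ) (hLaug : Laug = estimatorGain Saug (augC C CN DN) W)
    (L : Fin n → ℝ) (hL : L = estimatorGain S C W) :
    -- the `N` eigenvalues of `AN` are, with multiplicity, eigenvalues of the closed loop matrix
    AN.charpoly ∣ (closedLoop (augA A C AN BN) Laug (augC C CN DN)).charpoly ∧
    -- and they are, with multiplicity, uncontrollable eigenvalues
    (∀ μ ∈ spectrum ℂ (toComplex AN),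
      IsUncontrollableEigenvalue (augA A C AN BN) Laug μ ∧
      (toComplex AN).charpoly.rootMultiplicity μ ≤
        uncontrollableMultiplicity (augA A C AN BN) Laug μ) ∧
    -- the loop transfer function reduces to that of the estimator without delay
    transferFunction (augA A C AN BN) Laug (augC C CN DN) 0 = transferFunction A L C 0 ∧
    -- `(A, L, C)` is a minimal realization of it
    (Disjoint (spectrum ℂ (toComplex A)) (spectrum ℂ (toComplex (closedLoop A L C))) →
      IsMinimalRealization A L C 0
        (transferFunction (augA A C AN BN) Laug (augC C CN DN) 0)) ∧
    -- the tradeoff filter is well defined and equal to that of the estimator without delay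
    1 + transferFunction (augA A C AN BN) Laug (augC C CN DN) 0 ≠ 0 ∧
    (1 + transferFunction (augA A C AN BN) Laug (augC C CN DN) 0)⁻¹ =
      (1 + transferFunction A L C 0)⁻¹ := by
  obtain ⟨p, q, hp, hq, hq0, hdvd, hPpq⟩ := hP
  have hpade : IsPadePair N τ p q := ⟨hp, hq, hq0, hdvd⟩
  have hqne : q ≠ 0 := by rintro rfl; simp at hq0
  -- the delay model is stable and all-pass
  have hpq := charpoly_mul_eq_of_transferFunction_eq_div hqne (hmin.1.trans hPpq)
  set R := numerator AN BN CN + Polynomial.C DN * AN.charpoly with hR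
  -- `q` clears the denominator of the delay model, so it annihilates `BN` by observability and then
  -- all of `AN` by controllability; hence the eigenvalues of `AN` are roots of `q`.
  have hqAN : aeval AN q = 0 := by
    refine eq_zero_of_isControllable_aug hctr q (aeval_mulVec_eq_zero_of_charpoly_dvd AN BN CN
      (isObservable_of_isObservable_aug hobs) q ⟨p - q * Polynomial.C DN, ?_⟩)
    linear_combination -hpq
  have hANstable : ∀ z : ℂ, aeval z AN.charpoly = 0 → z.re < 0 := fun z hz =>
    hpade.re_neg_of_isRoot hτ z
      (aeval_eq_zero_of_mem_spectrum AN q hqAN z ((mem_spectrum_toComplex_iff AN z).2 hz))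
  have hallpass : R * R.comp (-X) = AN.charpoly * AN.charpoly.comp (-X) := by
    have h1 := congrArg (fun f : ℝ[X] => f.comp (-X)) hpq
    simp only [mul_comp] at h1
    have hqq : q * q.comp (-X) ≠ 0 := by
      refine mul_ne_zero hqne fun h0 => ?_
      have := congrArg (fun f : ℝ[X] => f.eval 0) h0
      simp [eval_comp, ← coeff_zero_eq_eval_zero, hq0] at this
    refine mul_left_cancel₀ hqq ?_
    linear_combination (AN.charpoly * AN.charpoly.comp (-X)) * hpade.mul_comp_neg_X -
      p.comp (-X) * AN.charpoly.comp (-X) * hpq - q * R * h1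
  -- the closed loop characteristic polynomials
  have hψstable := re_neg_of_isRoot_charpoly_closedLoop hV hW hAC hS
  have hφstable := re_neg_of_isRoot_charpoly_closedLoop hV hW hobs hSaug
  have hψ := eval_charpoly_closedLoop_mul A E C V W hW S hS
  have hφ := eval_charpoly_closedLoop_mul _ _ _ V W hW Saug hSaug
  rw [← hL] at hψstable hψ
  rw [← hLaug] at hφstable hφ
  set φ := (closedLoop (augA A C AN BN) Laug (augC C CN DN)).charpoly with hφdef
  set ψ := (closedLoop A L C).charpoly with hψdef
  have hfactor : φ = ψ * AN.charpoly := by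
    refine eq_of_mul_comp_neg_X_eq (Matrix.charpoly_monic _)
      ((Matrix.charpoly_monic _).mul (Matrix.charpoly_monic _)) hφstable ?_ ?_
    · intro z hz
      rw [map_mul, mul_eq_zero] at hz
      exact hz.elim (hψstable z) (hANstable z)
    · refine Polynomial.funext fun z => mul_left_cancel₀ hW.ne' ?_
      have h1 := congrArg (fun f : ℝ[X] => f.eval z) hallpass
      have h2 := hφ z
      rw [numerator_aug, charpoly_augA, ← hR] at h2
      simp only [eval_mul, eval_comp, eval_neg, eval_X] at h1 h2 ⊢
      linear_combination h2 + AN.charpoly.eval z * AN.charpoly.eval (-z) * (-hψ z) +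
        V * ((numerator A E C).eval z * (numerator A E C).eval (-z)) * h1
  have hχaug := charpoly_augA A C AN BN
  -- The loop numerator is φ - χχ_N = χ_N(ψ - χ), so multiplying it by χ makes it divisible by χχ_N.
  have hLzero : aeval (augA A C AN BN) A.charpoly *ᵥ Laug = 0 := by
    refine aeval_mulVec_eq_zero_of_charpoly_dvd _ _ _ hobs _ ⟨ψ - A.charpoly, ?_⟩
    have h1 := charpoly_closedLoop (augA A C AN BN) Laug (augC C CN DN)
    rw [← hφdef, hfactor, hχaug] at h1
    rw [hχaug]
    linear_combination -A.charpoly * h1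
  have hone : 1 + transferFunction (augA A C AN BN) Laug (augC C CN DN) 0 =
      1 + transferFunction A L C 0 := by
    have hA := RatFunc.algebraMap_ne_zero (Matrix.charpoly_monic A).ne_zero
    have hN := RatFunc.algebraMap_ne_zero (Matrix.charpoly_monic AN).ne_zero
    rw [one_add_transferFunction, one_add_transferFunction, ← hφdef, hfactor, hχaug, map_mul,
      map_mul, mul_div_mul_right _ _ hN]
  have htf := add_left_cancel hone
  refine ⟨hfactor ▸ dvd_mul_left _ _, fun μ hμ => ⟨?_, ?_⟩, htf, fun hdisj => ?_, ?_, ?_⟩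
  · refine isUncontrollableEigenvalue_of_charpoly_eq_mul _ _ _ hobs _ _ hχaug hLzero μ ?_
    rw [← toComplex_charpoly]
    exact Matrix.mem_spectrum_iff_isRoot_charpoly.1 hμ
  · rw [toComplex_charpoly]
    exact rootMultiplicity_le_uncontrollableMultiplicity _ _ _ hobs _ _ hχaug hLzero μ
  · rw [htf]
    apply isMinimalRealization_of_isCoprime
    have h1 := isCoprime_charpoly_of_disjoint_spectrum _ _ hdisj
    rw [charpoly_closedLoop] at h1
    -- ψ minus χ is the numerator, so coprimeness to χ passes from one to the other.
    have h2 := h1.add_mul_left_right (-1)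
    rwa [mul_neg_one, add_neg_cancel_comm] at h2
  · rw [hone, one_add_transferFunction]
    exact div_ne_zero (RatFunc.algebraMap_ne_zero (Matrix.charpoly_monic _).ne_zero)
      (RatFunc.algebraMap_ne_zero (Matrix.charpoly_monic _).ne_zero)
  · rw [hone]
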